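/- Let $d\ge 2$ and let $\mathbb T_d$ be the infinite tree in which every vertex has $d+1$ neighbours, with a distinguished root; write $u<v$ if $u\ne v$ and $u$ lies on the path from the root to $v$, and let $\operatorname{dist}$ be the graph distance. Let $(X_v)$ be independent random variables indexed by the vertices, with $\mathbb P(X_v=k)=(1-p)p^k$ for $k=0,1,2,\dots$, where $p\in(0,1)$. At time $0$ only the root is informed; at each step, each newly informed vertex $v$ informs all non-informed vertices $v'>v$ with $\operatorname{dist}(v,v')\le X_v$. The model percolates if infinitely many vertices are eventually informed, and $p_c^{\mathbf{cp}}(d)$ denotes the infimum of the $p\in(0,1)$ for which this has positive probability. Then, for every $d\ge2$, $p_c^{\mathbf{cp}}(d)$ is the unique solution $q\in(0,1)$ of $$\sum_{k\ge1}(dq)^k\prod_{i=1}^{k-1}(1-q^i)=1 .$$ More explicitly, $0.266667\le p_c^{\mathbf{cp}}(2)\le 0.277206$, and for every $d\ge3$ $$\frac{1}{2d-\frac14}\le p_c^{\mathbf{cp}}(d)\le\frac{(7d-1)\left(1-\sqrt{1-\frac{14}{(7d-1)^2}}\right)}{2}.$$ -/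

import Mathlib

noncomputable section

namespace ConePercolation

open MeasureTheory ProbabilityTheory

/-- Vertices of the rooted homogeneous tree in which every vertex has `d + 1` neighbours, coded by
words: the empty word is the root, and the children of a vertex `w` are the words `w ++ [a]`. The
first letter takes `d + 1` values and every later letter takes `d` values, so the root has `d + 1`
children and every other vertex has one parent and `d` children. -/
abbrev Vertex (d : ℕ) : Type :=
  {w : List (Fin (d + 1)) // ∀ a ∈ w.tail, (a : ℕ) < d}

/-- The root of the tree. -/
def root (d : ℕ) : Vertex d := ⟨[], by simp⟩

/-- The distance of a vertex to the root. -/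
def depth {d : ℕ} (v : Vertex d) : ℕ := v.1.length

/-- `u < v`: the vertex `u` is different from `v` and lies on the path from the root to `v`. -/
def Below {d : ℕ} (u v : Vertex d) : Prop := u ≠ v ∧ u.1 <+: v.1

/-- The vertices `v > u` at distance at most `r` from `u`. The path from `u` to such a `v` goes
away from the root, so the distance is the difference of the depths. -/
def cone {d : ℕ} (u : Vertex d) (r : ℕ) : Set (Vertex d) :=
  {v | Below u v ∧ depth v - depth u ≤ r}

/-- The set of vertices informed at time `n` or earlier when the radii are `X`: at time `0` only
the root is informed, and at each step each informed vertex `u` informs all vertices `v > u` at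
distance at most `X u`. (Vertices informed before the last step inform nobody new.) -/
def informedBy {d : ℕ} (X : Vertex d → ℕ) : ℕ → Set (Vertex d)
  | 0 => {root d}
  | n + 1 => informedBy X n ∪ ⋃ u ∈ informedBy X n, cone u (X u)

/-- The model percolates: infinitely many vertices are eventually informed. -/
def Percolates {d : ℕ} (X : Vertex d → ℕ) : Prop := (⋃ n, informedBy X n).Infinite

/-- The law of the radii: independent, with `P(X_v = k) = (1 - p) p ^ k` for `k = 0, 1, 2, …`. -/
def radiiLaw (d : ℕ) (p : unitInterval) : Measure (Vertex d → ℕ) :=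
  Measure.infinitePi fun _ => geometricMeasure (unitInterval.symm p)

/-- The probability that the model percolates. -/
def percolationProb (d : ℕ) (p : unitInterval) : ℝ :=
  (radiiLaw d p).real {X | Percolates X}

/-- The critical parameter: the infimum of the `p ∈ (0, 1)` for which the model percolates with
positive probability. -/
def criticalParameter (d : ℕ) : ℝ :=
  sInf {p : ℝ | ∃ hp : p ∈ Set.Ioo (0 : ℝ) 1,
    0 < percolationProb d ⟨p, Set.Ioo_subset_Icc_self hp⟩}

/-- `q` solves `∑_{k ≥ 1} c (d q) ^ k ∏_{i = 1}^{k - 1} (1 - c q ^ i) = 1`; the sum is indexed by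
`j = k - 1 ≥ 0`. -/
def SolvesLocalization (c : ℝ) (d : ℕ) (q : ℝ) : Prop :=
  HasSum (fun j : ℕ => c * (d * q) ^ (j + 1) * ∏ i ∈ Finset.Icc 1 j, (1 - c * q ^ i)) 1

end ConePercolation

end

namespace ConePercolation

open MeasureTheory ProbabilityTheory

/-! A vertex at depth `n` is informed exactly when every edge of its path from the root is covered
by the cone of an earlier vertex of that path (`covered_of_mem_informedBy`,
`mem_informedBy_of_covered`). The probability `coverProb p n` of this satisfies a renewal equation,
obtained by conditioning on the last vertex whose cone reaches the end. Hence `d ^ n * coverProb p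
n` is a renewal sequence whose weights are the summands `term d p j` of the localization series.

If the weights sum to less than 1, the renewal sequence is summable, so the expected number of
informed vertices is finite and there is no percolation. If they sum to more than 1, the sequence
exceeds 1 at some `N`; a supercritical branching structure with generations of `N` levels is then
embedded in the tree, and a second-moment estimate shows that it survives.

On `[0, 1/2]` each `term d x j / x` is nondecreasing in `x`, so any root `q` of the localization
equation separates the two regimes and equals the critical parameter (`criticalParameter_eq`), which
gives uniqueness. Existence and the explicit bounds come from the intermediate value theorem between
points where the series is at most, respectively at least, 1. -/

/-! ### Independent radii: restriction and independence. -/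

/-- The law of independent geometric radii indexed by an arbitrary type. -/
noncomputable def iidRadii (ι : Type*) (p : unitInterval) : Measure (ι → ℕ) :=
  Measure.infinitePi fun _ => geometricMeasure (unitInterval.symm p)

instance (ι : Type*) (p : unitInterval) : IsProbabilityMeasure (iidRadii ι p) := by
  unfold iidRadii; infer_instance

lemma measurePreserving_comp {ι κ : Type*} (p : unitInterval) {f : ι → κ}
    (hf : Function.Injective f) :
    MeasurePreserving (fun (x : κ → ℕ) i => x (f i)) (iidRadii κ p) (iidRadii ι p) where
  measurable := by fun_prop
  map_eq := Measure.map_infinitePi_infinitePi_of_inj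
    (P := fun _ => geometricMeasure (unitInterval.symm p)) hf

/-- The events that depend only on the radii in `S`. -/
@[reducible] def radiiSigma {ι : Type*} (S : Set ι) : MeasurableSpace (ι → ℕ) :=
  ⨆ i ∈ S, MeasurableSpace.comap (fun x : ι → ℕ => x i) inferInstance

lemma radiiSigma_le {ι : Type*} (S : Set ι) : radiiSigma S ≤ MeasurableSpace.pi :=
  iSup₂_le fun i _ => (measurable_pi_apply i).comap_le

lemma measurable_eval_radiiSigma {ι : Type*} {S : Set ι} {i : ι} (hi : i ∈ S) :
    Measurable[radiiSigma S] (fun x : ι → ℕ => x i) :=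
  Measurable.of_comap_le (le_iSup₂_of_le i hi le_rfl)

lemma measurable_comp_radiiSigma {ι κ : Type*} {S : Set κ} {f : ι → κ} (hf : ∀ i, f i ∈ S) :
    Measurable[radiiSigma S] (fun (x : κ → ℕ) i => x (f i)) :=
  @measurable_pi_lambda _ _ _ (radiiSigma S) _ _ fun i => measurable_eval_radiiSigma (hf i)

lemma measure_inter_of_disjoint {ι : Type*} (p : unitInterval) {S T : Set ι} (h : Disjoint S T)
    {A B : Set (ι → ℕ)} (hA : MeasurableSet[radiiSigma S] A)
    (hB : MeasurableSet[radiiSigma T] B) :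
    (iidRadii ι p).real (A ∩ B) = (iidRadii ι p).real A * (iidRadii ι p).real B := by
  have h1 : iIndepFun (fun (i : ι) (x : ι → ℕ) => x i) (iidRadii ι p) :=
    iIndepFun_infinitePi (X := fun _ k => k) (fun _ => measurable_id)
  have h2 := indep_iSup_of_disjoint (fun i => (measurable_pi_apply i).comap_le) h1 h
  simp only [measureReal_def, ← ENNReal.toReal_mul]
  rw [(Indep_iff _ _ _).1 h2 A B hA hB]

lemma geometric_tail (p : unitInterval) (hp : (p : ℝ) < 1) (k : ℕ) :
    (geometricMeasure (unitInterval.symm p)).real {n | n < k} = 1 - (p : ℝ) ^ k := by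
  have h0 : unitInterval.symm p ≠ 0 := by
    intro h
    have := congrArg Subtype.val h
    simp at this
    linarith
  have : {n | n < k} = ((Finset.range k : Finset ℕ) : Set ℕ) := by ext; simp
  rw [this, ← sum_measureReal_singleton]
  simp_rw [geometricMeasure_real_singleton h0]
  rw [← Finset.sum_mul]
  simp only [unitInterval.coe_symm_eq, sub_sub_cancel]
  linear_combination -(geom_sum_mul (p : ℝ) k)

lemma geometric_tail_ge (p : unitInterval) (hp : (p : ℝ) < 1) (k : ℕ) :
    (geometricMeasure (unitInterval.symm p)).real {n | k ≤ n} = (p : ℝ) ^ k := by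
  have : {n | k ≤ n} = {n | n < k}ᶜ := by ext; simp
  rw [this, probReal_compl_eq_one_sub (MeasurableSet.of_discrete), geometric_tail p hp]
  ring

/-! ### Covering of a ray and its renewal equation. -/

/-- Along a ray with radii `x`, the first `n` edges are covered. -/
def Covered (x : ℕ → ℕ) (n : ℕ) : Prop := ∀ i < n, ∃ j ≤ i, i + 1 ≤ x j + j

/-- Along a ray, `m` is the last position whose cone reaches position `n`. -/
def LastReach (x : ℕ → ℕ) (n m : ℕ) : Prop := n ≤ x m + m ∧ ∀ j, m < j → j < n → x j + j < n

/-- The cone of the last position `m` reaching `n` covers every edge from `m` to `n`, so only the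
first `m` edges remain to be covered. -/
lemma covered_iff_exists_lastReach (x : ℕ → ℕ) {n : ℕ} (hn : 0 < n) :
    Covered x n ↔ ∃ m < n, Covered x m ∧ LastReach x n m := by
  constructor
  · intro h
    obtain ⟨j, hj, hj'⟩ := h (n - 1) (by omega)
    let Q : ℕ → Prop := fun j => j < n ∧ n ≤ x j + j
    classical
    have hQ : Q j := ⟨by omega, by omega⟩
    have hm : Q (Nat.findGreatest Q n) := Nat.findGreatest_spec (show j ≤ n by omega) hQ
    refine ⟨_, hm.1, fun i hi => h i (by omega), hm.2, fun k hk hk' => ?_⟩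
    by_contra hc
    exact Nat.findGreatest_is_greatest hk hk'.le ⟨hk', by omega⟩
  · rintro ⟨m, hm, hc, hr⟩ i hi
    by_cases him : i < m
    · exact hc i him
    · exact ⟨m, by omega, by have := hr.1; omega⟩

lemma lastReach_unique {x : ℕ → ℕ} {n m m' : ℕ} (hm : m < n) (hm' : m' < n)
    (h : LastReach x n m) (h' : LastReach x n m') : m = m' := by
  rcases lt_trichotomy m m' with hlt | heq | hlt
  · have := h.2 m' hlt hm'; have := h'.1; omega
  · exact heq
  · have := h'.2 m hlt hm; have := h.1; omega

/-- The probability that the first `n` edges of a ray are covered. -/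
noncomputable def coverProb (p : unitInterval) (n : ℕ) : ℝ :=
  (iidRadii ℕ p).real {x | Covered x n}

/-- The probability that a given vertex is the latest one reaching a vertex `k` levels below. -/
def reachWeight (p : ℝ) (k : ℕ) : ℝ := p ^ k * ∏ i ∈ Finset.Icc 1 (k - 1), (1 - p ^ i)

lemma measurableSet_covered {ι : Type*} {S : Set ι} {f : ℕ → ι} {n : ℕ} (hf : ∀ j < n, f j ∈ S) :
    MeasurableSet[radiiSigma S] {x : ι → ℕ | Covered (fun j => x (f j)) n} := by
  have : {x : ι → ℕ | Covered (fun j => x (f j)) n} =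
      ⋂ i ∈ Finset.range n, ⋃ j ∈ Finset.range (i + 1),
        (fun x : ι → ℕ => x (f j)) ⁻¹' {k | i + 1 ≤ k + j} := by
    ext x; simp [Covered]
  rw [this]
  refine Finset.measurableSet_biInter _ fun i hi => Finset.measurableSet_biUnion _ fun j hj => ?_
  refine measurable_eval_radiiSigma (hf j ?_) MeasurableSet.of_discrete
  simp at hi hj; omega

lemma measurableSet_lastReach {n m : ℕ} :
    MeasurableSet[radiiSigma {j : ℕ | m ≤ j}] {x : ℕ → ℕ | LastReach x n m} := by
  have : {x : ℕ → ℕ | LastReach x n m} = ((fun x : ℕ → ℕ => x m) ⁻¹' {k | n ≤ k + m}) ∩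
      ⋂ j ∈ Finset.Ioo m n, (fun x : ℕ → ℕ => x j) ⁻¹' {k | k + j < n} := by
    ext x; simp [LastReach]
  rw [this]
  refine MeasurableSet.inter (measurable_eval_radiiSigma (by simp) MeasurableSet.of_discrete) ?_
  refine Finset.measurableSet_biInter _ fun j hj => ?_
  refine measurable_eval_radiiSigma ?_ MeasurableSet.of_discrete
  simp at hj ⊢; omega

/-- The event is a box: the radius at `m` is at least `n - m`, and each radius at an intermediate
`j` is less than `n - j`. The substitution `i = n - j` yields the product in `reachWeight`. -/
lemma measure_lastReach (p : unitInterval) (hp : (p : ℝ) < 1) {n m : ℕ} (hm : m < n) :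
    (iidRadii ℕ p).real {x | LastReach x n m} = reachWeight p (n - m) := by
  have : {x : ℕ → ℕ | LastReach x n m} = Set.pi (Finset.Ico m n : Finset ℕ)
      (fun j => if j = m then {k | n - m ≤ k} else {k | k < n - j}) := by
    ext x
    simp only [LastReach, Set.mem_ofPred_eq, Set.mem_pi, Finset.coe_Ico, Set.mem_Ico]
    constructor
    · rintro ⟨h1, h2⟩ j hj
      split_ifs with h
      · subst h; simp only [Set.mem_ofPred_eq]; omega
      · have := h2 j (by omega) hj.2
        simp only [Set.mem_ofPred_eq]; omega
    · intro h
      refine ⟨?_, fun j h1 h2 => ?_⟩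
      · have := h m ⟨le_rfl, hm⟩
        simp only [if_true, Set.mem_ofPred_eq] at this; omega
      · have := h j ⟨h1.le, h2⟩
        rw [if_neg (by omega)] at this
        simp only [Set.mem_ofPred_eq] at this; omega
  rw [this, measureReal_def, iidRadii, Measure.infinitePi_pi _ (fun _ _ => MeasurableSet.of_discrete),
    ENNReal.toReal_prod, Finset.prod_eq_prod_Ico_succ_bot hm, reachWeight, if_pos rfl]
  congr 1
  · exact geometric_tail_ge p hp _
  · refine Finset.prod_bij' (fun j _ => n - j) (fun i _ => n - i) ?_ ?_ ?_ ?_ ?_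
    · intro j hj; simp at hj ⊢; omega
    · intro j hj; simp at hj ⊢; omega
    · intro j hj; simp at hj ⊢; omega
    · intro j hj; simp at hj ⊢; omega
    · intro j hj
      rw [if_neg (by simp at hj; omega)]
      exact geometric_tail p hp _

lemma coverProb_zero (p : unitInterval) : coverProb p 0 = 1 := by
  simp [coverProb, Covered]

lemma coverProb_nonneg (p : unitInterval) (n : ℕ) : 0 ≤ coverProb p n := measureReal_nonneg

/-- Covering up to `m` depends on positions before `m`, while `LastReach x n m` depends on positions
from `m` on, so the two are independent. -/
lemma coverProb_recursion (p : unitInterval) (hp : (p : ℝ) < 1) {n : ℕ} (hn : 0 < n) :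
    coverProb p n = ∑ m ∈ Finset.range n, coverProb p m * reachWeight p (n - m) := by
  have : {x | Covered x n} =
      ⋃ m ∈ Finset.range n, ({x | Covered x m} ∩ {x | LastReach x n m}) := by
    ext x; simpa [and_left_comm] using covered_iff_exists_lastReach x hn
  rw [coverProb, this, measureReal_biUnion_finset]
  · refine Finset.sum_congr rfl fun m hm => ?_
    rw [measure_inter_of_disjoint p (S := {j | j < m}) (T := {j | m ≤ j}),
      measure_lastReach p hp (by simpa using hm), coverProb]
    · rw [Set.disjoint_left]; intro j; simp
    · exact measurableSet_covered (f := id) (by simp)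
    · exact measurableSet_lastReach
  · intro m hm m' hm' hne
    rw [Function.onFun, Set.disjoint_left]
    exact fun x h h' => hne (lastReach_unique (by simpa using hm) (by simpa using hm') h.2 h'.2)
  · intro m hm
    exact MeasurableSet.inter (radiiSigma_le {j | j < m} _ (measurableSet_covered (f := id) (by simp)))
      (radiiSigma_le _ _ measurableSet_lastReach)

lemma measure_covered_comp {ι : Type*} (p : unitInterval) {f : ℕ → ι}
    (hf : Function.Injective f) (n : ℕ) :
    (iidRadii ι p).real {x | Covered (fun j => x (f j)) n} = coverProb p n :=
  (measurePreserving_comp p hf).measureReal_preimage (s := {x | Covered x n})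
    (radiiSigma_le Set.univ _ (measurableSet_covered (f := id) (by simp))).nullMeasurableSet

/-! ### Informed vertices as ends of covered paths. -/

/-- A ray from the root that passes through `v`. -/
def ray {d : ℕ} (hd : 0 < d) (v : Vertex d) (j : ℕ) : Vertex d :=
  ⟨v.1.take j ++ List.replicate (j - v.1.length) 0, by
    intro a ha
    rcases h : v.1.take j with _ | ⟨b, l⟩
    · rw [h, List.nil_append] at ha
      have := List.eq_of_mem_replicate (List.mem_of_mem_tail ha)
      simpa [this] using hd
    · rw [h, List.cons_append, List.tail_cons, List.mem_append] at ha
      rcases ha with ha | ha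
      · refine v.2 a ?_
        rw [← List.take_append_drop j v.1, h, List.cons_append, List.tail_cons]
        exact List.mem_append_left _ ha
      · simpa [List.eq_of_mem_replicate ha] using hd⟩

lemma depth_ray {d : ℕ} (hd : 0 < d) (v : Vertex d) (j : ℕ) : depth (ray hd v j) = j := by
  simp [depth, ray]; omega

/-- The padding by zeros beyond `v` makes the path an injective sequence indexed by all of `ℕ`, as
`measure_covered_comp` requires. -/
lemma ray_injective {d : ℕ} (hd : 0 < d) (v : Vertex d) : Function.Injective (ray hd v) :=
  fun i j h => by rw [← depth_ray hd v i, h, depth_ray]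

lemma ray_of_le {d : ℕ} (hd : 0 < d) (v : Vertex d) {j : ℕ} (hj : j ≤ depth v) :
    (ray hd v j).1 = v.1.take j := by
  have : j - v.1.length = 0 := Nat.sub_eq_zero_of_le hj
  simp [ray, this]

lemma ray_depth {d : ℕ} (hd : 0 < d) (v : Vertex d) : ray hd v (depth v) = v :=
  Subtype.ext (by rw [ray_of_le hd v le_rfl]; exact List.take_length)

lemma ray_eq_of_prefix {d : ℕ} (hd : 0 < d) {u v : Vertex d} (h : u.1 <+: v.1) {j : ℕ}
    (hj : j ≤ depth u) : ray hd u j = ray hd v j := by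
  have hle : depth u ≤ depth v := h.length_le
  refine Subtype.ext ?_
  rw [ray_of_le hd u hj, ray_of_le hd v (hj.trans hle)]
  obtain ⟨t, ht⟩ := h
  rw [← ht, List.take_append_of_le_length hj]

lemma covered_of_mem_informedBy {d : ℕ} (hd : 0 < d) (X : Vertex d → ℕ) (n : ℕ) :
    ∀ v ∈ informedBy X n, Covered (fun j => X (ray hd v j)) (depth v) := by
  induction n with
  | zero =>
    rintro v rfl i hi
    simp [depth, root] at hi
  | succ n ih =>
    rintro v (hv | hv)
    · exact ih v hv
    · simp only [Set.mem_iUnion] at hv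
      obtain ⟨u, hu, ⟨⟨-, hpre⟩, hdist⟩⟩ := hv
      intro i hi
      by_cases hiu : i < depth u
      · obtain ⟨j, hj, hj'⟩ := ih u hu i hiu
        exact ⟨j, hj, by simpa [ray_eq_of_prefix hd hpre (show j ≤ depth u by omega)] using hj'⟩
      · refine ⟨depth u, by omega, ?_⟩
        have h1 : ray hd v (depth u) = u := by
          rw [← ray_eq_of_prefix hd hpre le_rfl, ray_depth]
        simp only [h1]
        omega

lemma mem_informedBy_of_covered {d : ℕ} (hd : 0 < d) (X : Vertex d → ℕ) (v : Vertex d)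
    (hv : Covered (fun j => X (ray hd v j)) (depth v)) : v ∈ ⋃ n, informedBy X n := by
  have key : ∀ m ≤ depth v, ray hd v m ∈ ⋃ n, informedBy X n := by
    intro m
    induction m using Nat.strong_induction_on with
    | _ m ih =>
      intro hm
      rcases Nat.eq_zero_or_pos m with rfl | hpos
      · refine Set.mem_iUnion.2 ⟨0, Subtype.ext ?_⟩
        rw [ray_of_le hd v hm]; simp [root]
      · obtain ⟨j, hj, hj'⟩ := hv (m - 1) (by omega)
        obtain ⟨n, hn⟩ := Set.mem_iUnion.1 (ih j (by omega) (by omega))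
        refine Set.mem_iUnion.2 ⟨n + 1, Or.inr ?_⟩
        simp only [Set.mem_iUnion]
        refine ⟨_, hn, ⟨fun h => ?_, ?_⟩, ?_⟩
        · have := ray_injective hd v h; omega
        · rw [ray_of_le hd v (by omega), ray_of_le hd v hm]
          exact List.take_prefix_take_left (by omega)
        · rw [depth_ray, depth_ray]
          simp only at hj'
          omega
  simpa [ray_depth] using key _ le_rfl

/-! ### Subcritical phase. -/

lemma tsum_vertex_le {d : ℕ} (hd : 0 < d) (g : ℕ → ENNReal) :
    ∑' v : Vertex d, g (depth v) ≤ ∑' n : ℕ, (d + 1 : ℕ) * (d : ENNReal) ^ n * g n := by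
  -- At `n = 0` the root receives several labels; this is harmless, since an upper bound needs only
  -- surjectivity.
  let f : (Σ n : ℕ, Fin (d + 1) × (Fin (n - 1) → Fin d)) → Vertex d := fun o =>
    match o with
    | ⟨0, _⟩ => root d
    | ⟨n + 1, a, u⟩ => ⟨a :: List.ofFn (fun i : Fin n => (u i).castSucc), by
        intro b hb
        simp only [List.tail_cons, List.mem_ofFn] at hb
        obtain ⟨i, rfl⟩ := hb
        simp⟩
  have hf : Function.Surjective f := by
    rintro ⟨w, hw⟩
    rcases w with _ | ⟨a, l⟩
    · exact ⟨⟨0, 0, fun _ => ⟨0, hd⟩⟩, rfl⟩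
    · refine ⟨⟨l.length + 1, a, fun i : Fin l.length => ⟨l[i], hw _ (List.getElem_mem _)⟩⟩,
        Subtype.ext ?_⟩
      simp [f, Fin.castSucc]
  refine (ENNReal.tsum_le_tsum_comp_of_surjective hf _).trans ?_
  have h1 : ∀ o, depth (f o) = o.1 := by
    rintro ⟨_ | n, a, u⟩ <;> simp [f, depth, root]
  simp only [h1]
  rw [ENNReal.tsum_sigma']
  refine ENNReal.tsum_le_tsum fun n => ?_
  dsimp only
  rw [tsum_fintype, Finset.sum_const, nsmul_eq_mul]
  refine mul_le_mul_left ?_ _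
  have : (d + 1) * d ^ (n - 1) ≤ (d + 1) * d ^ n :=
    Nat.mul_le_mul_left _ (Nat.pow_le_pow_right hd (Nat.sub_le n 1))
  simpa using (show (((d + 1) * d ^ (n - 1) : ℕ) : ENNReal) ≤ ((d + 1) * d ^ n : ℕ) from
    Nat.cast_le.2 this)

/-- Borel–Cantelli: the probabilities that the paths to the vertices are covered have a finite sum,
so almost surely only finitely many paths are covered. -/
lemma percolationProb_eq_zero {d : ℕ} (hd : 0 < d) (p : unitInterval)
    (h : Summable fun n => (d : ℝ) ^ n * coverProb p n) : percolationProb d p = 0 := by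
  have hmeas : ∀ v : Vertex d, iidRadii (Vertex d) p
      {X | Covered (fun j => X (ray hd v j)) (depth v)} =
        ENNReal.ofReal (coverProb p (depth v)) := fun v => by
    rw [← measure_covered_comp p (ray_injective hd v), measureReal_def,
      ENNReal.ofReal_toReal (measure_ne_top _ _)]
  have hsum : ∑' v : Vertex d, iidRadii (Vertex d) p
      {X | Covered (fun j => X (ray hd v j)) (depth v)} ≠ ⊤ := by
    simp_rw [hmeas]
    refine ne_top_of_le_ne_top ?_ (tsum_vertex_le hd fun n => ENNReal.ofReal (coverProb p n))
    convert (h.mul_left (d + 1 : ℝ)).tsum_ofReal_ne_top using 4 with n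
    have : (d + 1 : ℝ) * ((d : ℝ) ^ n * coverProb p n) =
        (d + 1 : ℕ) * (d : ℝ) ^ n * coverProb p n := by
      push_cast; ring
    rw [this, ENNReal.ofReal_mul (by positivity), ENNReal.ofReal_mul (by positivity),
      ENNReal.ofReal_natCast, ENNReal.ofReal_pow (by positivity), ENNReal.ofReal_natCast]
  have hae := ae_finite_setOfPred_mem hsum
  have : (radiiLaw d p) {X | Percolates X} = 0 := by
    refine measure_mono_null ?_ (ae_iff.1 hae)
    intro X hX hfin
    refine hX (hfin.subset ?_)
    intro v hv
    obtain ⟨n, hn⟩ := Set.mem_iUnion.1 hv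
    exact covered_of_mem_informedBy hd X n v hn
  simp [percolationProb, measureReal_def, this]

/-! ### Supercritical phase: second moment and embedded generations. -/

/-- The second-moment lower bound for the probability of a finite union. -/
lemma measure_iUnion_ge {Ω κ : Type*} [MeasurableSpace Ω] [Fintype κ] (μ : Measure Ω)
    [IsProbabilityMeasure μ] {C : κ → Set Ω} (hC : ∀ w, MeasurableSet (C w)) (c : ℝ) :
    2 * c * ∑ w, μ.real (C w) - c ^ 2 * ∑ w, ∑ w', μ.real (C w ∩ C w') ≤ μ.real (⋃ w, C w) := by
  have hint : ∀ {A : Set Ω}, MeasurableSet A → Integrable (A.indicator (1 : Ω → ℝ)) μ :=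
    fun hA => (integrable_const (1 : ℝ)).indicator hA
  have hU := MeasurableSet.iUnion hC
  have h1 : ∫ x, (2 * c * ∑ w, (C w).indicator (1 : Ω → ℝ) x -
      c ^ 2 * ∑ w, ∑ w', (C w ∩ C w').indicator (1 : Ω → ℝ) x) ∂μ ≤
      ∫ x, (⋃ w, C w).indicator (1 : Ω → ℝ) x ∂μ := by
    refine integral_mono ?_ (hint hU) fun x => ?_
    · exact ((integrable_finsetSum _ fun w _ => hint (hC w)).const_mul _).sub
        ((integrable_finsetSum _ fun w _ => integrable_finsetSum _ fun w' _ =>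
          hint ((hC w).inter (hC w'))).const_mul _)
    · have h2 : ∑ w, ∑ w', (C w ∩ C w').indicator (1 : Ω → ℝ) x =
          (∑ w, (C w).indicator (1 : Ω → ℝ) x) ^ 2 := by
        rw [sq, Finset.sum_mul_sum]
        simp [Set.inter_indicator_one]
      simp only [h2]
      by_cases hx : x ∈ ⋃ w, C w
      · rw [Set.indicator_of_mem hx, Pi.one_apply]
        -- With `Z` the number of sets `C w` containing `x`, this is `2cZ - c²Z² ≤ 1`.
        nlinarith [sq_nonneg (1 - c * ∑ w, (C w).indicator (1 : Ω → ℝ) x)]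
      · have h3 : ∀ w, (C w).indicator (1 : Ω → ℝ) x = 0 := fun w =>
          Set.indicator_of_notMem (fun h => hx (Set.mem_iUnion.2 ⟨w, h⟩)) _
        simp [h3, Set.indicator_of_notMem hx]
  rw [integral_indicator_one hU, integral_sub, integral_const_mul, integral_const_mul,
    integral_finsetSum, integral_finsetSum] at h1
  · convert h1 using 3
    · exact Finset.sum_congr rfl fun w _ => (integral_indicator_one (hC w)).symm
    · refine Finset.sum_congr rfl fun w _ => ?_
      rw [integral_finsetSum _ fun w' _ => hint ((hC w).inter (hC w'))]
      exact Finset.sum_congr rfl fun w' _ =>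
        (integral_indicator_one ((hC w).inter (hC w'))).symm
  · exact fun w _ => integrable_finsetSum _ fun w' _ => hint ((hC w).inter (hC w'))
  · exact fun w _ => hint (hC w)
  · exact (integrable_finsetSum _ fun w _ => hint (hC w)).const_mul _
  · exact (integrable_finsetSum _ fun w _ => integrable_finsetSum _ fun w' _ =>
      hint ((hC w).inter (hC w'))).const_mul _

/-- In the tree of words over `α`, the path from the root to `w` is covered. -/
def CoveredWord {α : Type*} (X : List α → ℕ) (w : List α) : Prop :=
  Covered (fun j => X (w.take j)) w.length

lemma coveredWord_append {α : Type*} {X : List α → ℕ} {w w' : List α} (h : CoveredWord X w)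
    (h' : CoveredWord (fun l => X (w ++ l)) w') : CoveredWord X (w ++ w') := by
  intro i hi
  rw [List.length_append] at hi
  by_cases hiw : i < w.length
  · obtain ⟨j, hj, hj'⟩ := h i hiw
    exact ⟨j, hj, by simpa only [List.take_append_of_le_length (show j ≤ w.length by omega)]⟩
  · obtain ⟨j, hj, hj'⟩ := h' (i - w.length) (by omega)
    refine ⟨w.length + j, by omega, ?_⟩
    simp only [List.take_length_add_append] at hj' ⊢
    omega

/-- There are `n` successive generations of words, each obtained from the previous one by a covered
path of length `N`. -/
def Generations (α : Type*) (N : ℕ) : ℕ → Set (List α → ℕ)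
  | 0 => Set.univ
  | n + 1 => ⋃ u : Fin N → α, {X | CoveredWord X (List.ofFn u)} ∩
      (fun X l => X (List.ofFn u ++ l)) ⁻¹' Generations α N n

lemma exists_coveredWord {α : Type*} {N n : ℕ} {X : List α → ℕ} (h : X ∈ Generations α N n) :
    ∃ w : List α, w.length = n * N ∧ CoveredWord X w := by
  induction n generalizing X with
  | zero => exact ⟨[], by simp, fun i hi => by simp at hi⟩
  | succ n ih =>
    obtain ⟨u, hu, hu'⟩ := Set.mem_iUnion.1 h
    obtain ⟨w, hw, hw'⟩ := ih hu'
    exact ⟨List.ofFn u ++ w, by simp [hw]; ring, coveredWord_append hu hw'⟩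

lemma generations_succ_subset {α : Type*} (N n : ℕ) :
    Generations α N (n + 1) ⊆ Generations α N n := by
  induction n with
  | zero => exact Set.subset_univ _
  | succ n ih =>
    exact Set.iUnion_mono fun u => Set.inter_subset_inter_right _ (Set.preimage_mono ih)

lemma measurableSet_coveredWord {α : Type*} (w : List α) :
    MeasurableSet[radiiSigma {l : List α | l.length < w.length}] {X | CoveredWord X w} :=
  measurableSet_covered fun j hj => by simp; omega

lemma measurableSet_generations {α : Type*} [Fintype α] (N n : ℕ) :
    MeasurableSet (Generations α N n) := by
  induction n with
  | zero => exact MeasurableSet.univ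
  | succ n ih =>
    exact MeasurableSet.iUnion fun u => ((radiiSigma_le _ _ (measurableSet_coveredWord _)).inter
      ((measurable_pi_lambda _ fun l => measurable_pi_apply _) ih))

lemma measurableSet_shift {α : Type*} [Fintype α] (N n : ℕ) (w : List α) :
    MeasurableSet[radiiSigma {l | w <+: l}]
      ((fun (X : List α → ℕ) l => X (w ++ l)) ⁻¹' Generations α N n) :=
  measurable_comp_radiiSigma (f := fun l => w ++ l) (fun l => List.prefix_append w l) (measurableSet_generations N n)

lemma measure_coveredWord {α : Type*} [Inhabited α] (p : unitInterval) (w : List α) :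
    (iidRadii (List α) p).real {X | CoveredWord X w} = coverProb p w.length := by
  have hinj : Function.Injective
      fun j => w.take j ++ List.replicate (j - w.length) (default : α) := by
    intro i j h
    have := congrArg List.length h
    simp at this
    omega
  rw [← measure_covered_comp p hinj]
  congr 1
  ext X
  simp only [CoveredWord, Covered, Set.mem_ofPred_eq]
  refine forall₂_congr fun i hi => exists_congr fun j => and_congr_right fun hj => ?_
  rw [Nat.sub_eq_zero_of_le (show j ≤ w.length by omega), List.replicate_zero, List.append_nil]

/-- The bound `δ` does not deteriorate with `n`: the slack of the mean `t` above 1 absorbs the pair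
correlations, which are crudely bounded over all pairs of words. -/
lemma measure_generations_ge {α : Type*} [Fintype α] [Inhabited α] (p : unitInterval) {N : ℕ}
    {δ : ℝ} (hδ : 0 < δ) (hδ1 : δ ≤ 1)
    (h : 1 + (Fintype.card α : ℝ) ^ (2 * N) * δ ≤ (Fintype.card α : ℝ) ^ N * coverProb p N)
    (n : ℕ) : δ ≤ (iidRadii (List α) p).real (Generations α N n) := by
  induction n with
  | zero => simpa [Generations] using hδ1
  | succ n ih =>
    set μ := iidRadii (List α) p
    set θ := μ.real (Generations α N n) with hθ
    set t := (Fintype.card α : ℝ) ^ N * coverProb p N with ht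
    let D : (Fin N → α) → Set (List α → ℕ) := fun u =>
      (fun X l => X (List.ofFn u ++ l)) ⁻¹' Generations α N n
    let C : (Fin N → α) → Set (List α → ℕ) := fun u => {X | CoveredWord X (List.ofFn u)} ∩ D u
    have hD : ∀ u, μ.real (D u) = θ := fun u =>
      (measurePreserving_comp p (List.append_right_injective (List.ofFn u))).measureReal_preimage
        (measurableSet_generations N n).nullMeasurableSet
    have hC : ∀ u, μ.real (C u) = coverProb p N * θ := fun u => by
      rw [measure_inter_of_disjoint p _ (measurableSet_coveredWord _) (measurableSet_shift N n _),
        measure_coveredWord, List.length_ofFn]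
      · exact congrArg _ (hD u)
      · rw [Set.disjoint_left]
        intro l hl hl'
        have := List.IsPrefix.length_le hl'
        simp at hl this
        omega
    -- The covering events are dropped; what remains is independent, because distinct words of equal
    -- length have no common extension.
    have hCC : ∀ u u', u ≠ u' → μ.real (C u ∩ C u') ≤ θ ^ 2 := fun u u' hu => by
      calc μ.real (C u ∩ C u') ≤ μ.real (D u ∩ D u') :=
            measureReal_mono (Set.inter_subset_inter Set.inter_subset_right Set.inter_subset_right)
        _ = θ ^ 2 := by
          rw [measure_inter_of_disjoint p _ (measurableSet_shift N n _) (measurableSet_shift N n _),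
            sq]
          · exact congrArg₂ _ (hD u) (hD u')
          · rw [Set.disjoint_left]
            intro l hl hl'
            exact hu (List.ofFn_injective
              ((List.prefix_of_prefix_length_le hl hl' (by simp)).eq_of_length (by simp)))
    have hmeas : ∀ u, MeasurableSet (C u) := fun u =>
      (radiiSigma_le _ _ (measurableSet_coveredWord _)).inter
        (radiiSigma_le _ _ (measurableSet_shift N n _))
    have hcard : ((Finset.univ : Finset (Fin N → α)).card : ℝ) = (Fintype.card α : ℝ) ^ N := by
      simp
    have hsum : ∑ u, μ.real (C u) = t * θ := by
      simp only [hC]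
      rw [Finset.sum_const, nsmul_eq_mul, hcard, ht]
      ring
    have hsum2 : ∑ u, ∑ u', μ.real (C u ∩ C u') ≤
        t * θ + (Fintype.card α : ℝ) ^ (2 * N) * θ ^ 2 := by
      classical
      calc ∑ u, ∑ u', μ.real (C u ∩ C u') ≤
            ∑ u, ∑ u', ((if u = u' then μ.real (C u) else 0) + θ ^ 2) := by
            refine Finset.sum_le_sum fun u _ => Finset.sum_le_sum fun u' _ => ?_
            split_ifs with h
            · subst h; rw [Set.inter_self]; nlinarith [sq_nonneg θ]
            · rw [zero_add]; exact hCC u u' h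
        _ = _ := by
            simp only [Finset.sum_add_distrib, Finset.sum_ite_eq, Finset.mem_univ, if_true, hsum,
              Finset.sum_const, nsmul_eq_mul, hcard]
            ring
    have hθ0 : 0 < θ := hδ.trans_le ih
    -- The choice `c = δ / θ` turns the terms in `θ` into terms in `δ`; since `δ / θ ≤ 1`, the bound
    -- is at least `δ * (t - card ^ (2 * N) * δ) ≥ δ`.
    have key := measure_iUnion_ge μ hmeas (δ / θ)
    refine le_trans ?_ key
    rw [hsum]
    have hle : δ / θ ≤ 1 := (div_le_one hθ0).2 ih
    have hx : δ / θ * θ = δ := div_mul_cancel₀ _ hθ0.ne'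
    have hx0 : 0 ≤ δ / θ := by positivity
    have ht0 : 0 ≤ t := by positivity [coverProb_nonneg p N]
    calc δ ≤ 2 * t * δ - t * δ - (Fintype.card α : ℝ) ^ (2 * N) * δ ^ 2 := by nlinarith
      _ ≤ 2 * t * δ - t * δ * (δ / θ) - (Fintype.card α : ℝ) ^ (2 * N) * δ ^ 2 := by
          nlinarith [mul_nonneg (mul_nonneg ht0 hδ.le) (sub_nonneg.2 hle)]
      _ = 2 * (δ / θ) * (t * θ) -
            (δ / θ) ^ 2 * (t * θ + (Fintype.card α : ℝ) ^ (2 * N) * θ ^ 2) := by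
          linear_combination (-2 * t + t * (δ / θ)  + (Fintype.card α : ℝ) ^ (2 * N) * (δ / θ * θ + δ)) * hx
      _ ≤ _ := by
          have := mul_le_mul_of_nonneg_left hsum2 (sq_nonneg (δ / θ))
          linarith

lemma percolationProb_pos {d : ℕ} (hd : 0 < d) (p : unitInterval) {N : ℕ}
    (h : 1 < (d : ℝ) ^ N * coverProb p N) : 0 < percolationProb d p := by
  have hN : 0 < N := by
    rcases Nat.eq_zero_or_pos N with rfl | hN
    · simp [coverProb_zero] at h
    · exact hN
  have hinh : Inhabited (Fin d) := ⟨⟨0, hd⟩⟩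
  let G : Set (List (Fin d) → ℕ) := ⋂ n, Generations (Fin d) N n
  have hG : 0 < (iidRadii (List (Fin d)) p).real G := by
    set t := (d : ℝ) ^ N * coverProb p N
    have hc : (0 : ℝ) < (d : ℝ) ^ (2 * N) := by positivity
    obtain ⟨δ, hδ0, hδ⟩ : ∃ δ : ℝ, 0 < δ ∧ δ ≤ 1 ∧ 1 + (d : ℝ) ^ (2 * N) * δ ≤ t := by
      refine ⟨min 1 ((t - 1) / (d : ℝ) ^ (2 * N)), ?_, min_le_left _ _, ?_⟩
      · exact lt_min one_pos (div_pos (by linarith) hc)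
      · have := mul_le_mul_of_nonneg_left (min_le_right 1 ((t - 1) / (d : ℝ) ^ (2 * N))) hc.le
        rw [mul_div_cancel₀ _ hc.ne'] at this
        linarith
    have hge := fun n => measure_generations_ge (α := Fin d) p hδ0 hδ.1 (by simpa using hδ.2) n
    have hanti : Antitone (Generations (Fin d) N) := antitone_nat_of_succ_le
      (generations_succ_subset N)
    have hlim := tendsto_measure_iInter_atTop (μ := iidRadii (List (Fin d)) p)
      (fun n => (measurableSet_generations (α := Fin d) N n).nullMeasurableSet) hanti
      ⟨0, measure_ne_top _ _⟩
    have : ENNReal.ofReal δ ≤ iidRadii (List (Fin d)) p G := by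
      refine ge_of_tendsto' hlim fun n => ?_
      exact (ENNReal.ofReal_le_iff_le_toReal (measure_ne_top _ _)).2 (hge n)
    exact hδ0.trans_le ((ENNReal.ofReal_le_iff_le_toReal (measure_ne_top _ _)).1 this)
  -- The `d`-ary tree sits inside the tree as the vertices whose first letter avoids the extra
  -- value.
  let f : List (Fin d) → Vertex d := fun l => ⟨l.map Fin.castSucc, by
    intro a ha
    obtain ⟨b, -, rfl⟩ := List.mem_map.1 (List.mem_of_mem_tail ha)
    simp⟩
  have hf : Function.Injective f := fun l l' h =>
    List.map_injective_iff.2 (Fin.castSucc_injective d) (congrArg Subtype.val h)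
  have hlen : ∀ l, depth (f l) = l.length := fun l => by simp [f, depth]
  have hray : ∀ l j, j ≤ l.length → ray hd (f l) j = f (l.take j) := fun l j hj =>
    Subtype.ext (by rw [ray_of_le hd _ (by rwa [hlen])]; simp [f, List.map_take])
  rw [← (measurePreserving_comp p hf).measureReal_preimage
    (MeasurableSet.iInter fun n => measurableSet_generations N n).nullMeasurableSet] at hG
  refine hG.trans_le (measureReal_mono ?_ (measure_ne_top (iidRadii (Vertex d) p) _))
  intro X hX hfin
  -- Informed vertices of unbounded depth suffice: `b + 1` generations reach depth `(b + 1) * N >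
  -- b`.
  obtain ⟨b, hb⟩ := (hfin.image depth).bddAbove
  obtain ⟨w, hw, hcov⟩ := exists_coveredWord (Set.mem_iInter.1 hX (b + 1))
  have hmem := mem_informedBy_of_covered hd X (f w) (by
    rw [hlen]
    intro i hi
    obtain ⟨j, hj, hj'⟩ := hcov i hi
    exact ⟨j, hj, by simpa only [hray w j (by omega)] using hj'⟩)
  have := hb ⟨_, hmem, rfl⟩
  rw [hlen, hw] at this
  have := Nat.le_mul_of_pos_right (b + 1) hN
  omega

/-! ### Renewal sequences and the localization series. -/

/-- The summand of the localization equation. -/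
noncomputable def term (d : ℕ) (q : ℝ) (j : ℕ) : ℝ :=
  (d * q) ^ (j + 1) * ∏ i ∈ Finset.Icc 1 j, (1 - q ^ i)

lemma solvesLocalization_one_iff {d : ℕ} {q : ℝ} :
    SolvesLocalization 1 d q ↔ HasSum (term d q) 1 := by
  simp only [SolvesLocalization, one_mul]
  rfl

lemma sum_renewal_le {t a : ℕ → ℝ} (ht : ∀ n, 0 ≤ t n) (ha : ∀ n, 0 ≤ a n) (ht0 : t 0 = 1)
    (hrec : ∀ n, t (n + 1) = ∑ m ∈ Finset.range (n + 1), t m * a (n - m)) (M : ℕ) :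
    ∑ n ∈ Finset.range (M + 1), t n ≤
      1 + (∑ n ∈ Finset.range M, t n) * ∑ j ∈ Finset.range M, a j := by
  rw [Finset.sum_range_succ', ht0, add_comm]
  refine add_le_add le_rfl ?_
  simp_rw [hrec]
  rw [Finset.sum_comm' (t' := Finset.range M) (s' := fun m => Finset.Ico m M)
    (by intro x y; simp; omega), Finset.sum_mul]
  refine Finset.sum_le_sum fun m hm => ?_
  rw [← Finset.mul_sum, Finset.sum_Ico_eq_sum_range]
  refine mul_le_mul_of_nonneg_left ?_ (ht m)
  simp only [Nat.add_sub_cancel_left]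
  exact Finset.sum_le_sum_of_subset_of_nonneg
    (Finset.range_subset_range.2 (Nat.sub_le _ _)) fun i _ _ => ha i

/-- The partial sums `S` of `t` satisfy `S ≤ 1 + A * S`, hence `S ≤ 1 / (1 - A)`. -/
lemma summable_renewal {t a : ℕ → ℝ} (ht : ∀ n, 0 ≤ t n) (ha : ∀ n, 0 ≤ a n) (ht0 : t 0 = 1)
    (hrec : ∀ n, t (n + 1) = ∑ m ∈ Finset.range (n + 1), t m * a (n - m)) {A : ℝ} (hA : A < 1)
    (hsum : ∀ K, ∑ j ∈ Finset.range K, a j ≤ A) : Summable t := by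
  refine summable_of_sum_range_le (c := 1 / (1 - A)) ht fun M => ?_
  rw [le_div_iff₀ (by linarith)]
  have h0 : 0 ≤ ∑ n ∈ Finset.range M, t n := Finset.sum_nonneg fun i _ => ht i
  have h1 := sum_renewal_le ht ha ht0 hrec M
  have h2 := mul_le_mul_of_nonneg_left (hsum M) h0
  have h3 : ∑ n ∈ Finset.range M, t n ≤ ∑ n ∈ Finset.range (M + 1), t n := by
    rw [Finset.sum_range_succ]; linarith [ht M]
  linarith

/-- Damping the weights by `s ^ (j + 1)` with `s < 1` close to 1 keeps their sum above 1. Then `t n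
* s ^ n` stays above a constant `c > 0`, so `t n ≥ c / s ^ n` is unbounded. -/
lemma exists_one_lt_renewal {t a : ℕ → ℝ} (ht : ∀ n, 0 < t n) (ha : ∀ n, 0 ≤ a n)
    (hrec : ∀ n, t (n + 1) = ∑ m ∈ Finset.range (n + 1), t m * a (n - m)) {K : ℕ}
    (hK : 1 < ∑ j ∈ Finset.range K, a j) : ∃ n, 1 < t n := by
  obtain ⟨s, hs0, hs1, hs⟩ : ∃ s : ℝ, 0 < s ∧ s < 1 ∧
      1 < ∑ j ∈ Finset.range K, a j * s ^ (j + 1) := by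
    have hc : ContinuousAt (fun s : ℝ => ∑ j ∈ Finset.range K, a j * s ^ (j + 1)) 1 := by
      fun_prop
    have hev := hc.eventually (lt_mem_nhds (show (1 : ℝ) <
      ∑ j ∈ Finset.range K, a j * (1 : ℝ) ^ (j + 1) by simpa using hK))
    obtain ⟨l, hl, hl'⟩ := exists_Ioc_subset_of_mem_nhds hev ⟨0, one_pos⟩
    refine ⟨max ((l + 1) / 2) (1 / 2), by positivity, max_lt (by linarith) (by norm_num), ?_⟩
    exact hl' ⟨lt_max_of_lt_left (by linarith), max_le (by linarith) (by norm_num)⟩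
  obtain ⟨c, hc0, hc⟩ : ∃ c > 0, ∀ n < K, c ≤ t n * s ^ n := by
    rcases Nat.eq_zero_or_pos K with rfl | hKpos
    · exact ⟨1, one_pos, by simp⟩
    · obtain ⟨m, -, hm⟩ := Finset.exists_min_image (Finset.range K) (fun n => t n * s ^ n)
        ⟨0, by simpa using hKpos⟩
      exact ⟨t m * s ^ m, mul_pos (ht m) (by positivity), fun n hn => hm n (by simpa using hn)⟩
  have hall : ∀ n, c ≤ t n * s ^ n := by
    intro n
    induction n using Nat.strong_induction_on with
    | _ n ih =>
      by_cases hn : n < K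
      · exact hc n hn
      · rcases n with _ | n
        · have : K = 0 := by omega
          subst this; simp at hK; linarith
        · calc c ≤ c * ∑ j ∈ Finset.range K, a j * s ^ (j + 1) := by nlinarith
            _ ≤ c * ∑ j ∈ Finset.range (n + 1), a j * s ^ (j + 1) := by
              refine mul_le_mul_of_nonneg_left ?_ hc0.le
              exact Finset.sum_le_sum_of_subset_of_nonneg
                (Finset.range_subset_range.2 (by omega))
                fun i _ _ => mul_nonneg (ha i) (by positivity)
            _ ≤ ∑ m ∈ Finset.range (n + 1), t m * a (n - m) * s ^ (n + 1) := by
              rw [← Finset.sum_range_reflect, Finset.mul_sum]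
              refine Finset.sum_le_sum fun m hm => ?_
              have hm' : m ≤ n := by simp at hm; omega
              have h1 : n + 1 - 1 - m = n - m := by omega
              have h2 : s ^ (n + 1) = s ^ m * s ^ (n - m + 1) := by
                rw [← pow_add]; congr 1; omega
              rw [h1, h2]
              have := mul_le_mul_of_nonneg_right (ih m (by omega))
                (mul_nonneg (ha (n - m)) (pow_nonneg hs0.le (n - m + 1)))
              linarith
            _ = t (n + 1) * s ^ (n + 1) := by rw [hrec, Finset.sum_mul]
  obtain ⟨n, hn⟩ := exists_pow_lt_of_lt_one hc0 hs1
  refine ⟨n, ?_⟩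
  by_contra hle
  have := mul_le_mul_of_nonneg_right (not_lt.1 hle) (pow_nonneg hs0.le n)
  linarith [hall n]

lemma term_pos {d : ℕ} (hd : 0 < d) {q : ℝ} (hq0 : 0 < q) (hq1 : q < 1) (j : ℕ) :
    0 < term d q j := by
  refine mul_pos (by positivity) (Finset.prod_pos fun i hi => ?_)
  have := pow_lt_one₀ hq0.le hq1 (show i ≠ 0 by simp at hi; omega)
  linarith

/-- In other words, `x * (1 - x ^ n)` is nondecreasing on `[0, 1/2]`. In the induction step the
factors `q` and `p ^ (n + 1)` are each at most `1/2`. -/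
lemma pow_sub_pow_le_sub {p q : ℝ} (hp : 0 ≤ p) (hpq : p ≤ q) (hq : q ≤ 1 / 2) (n : ℕ) :
    q ^ (n + 1) - p ^ (n + 1) ≤ q - p := by
  induction n with
  | zero => simp
  | succ n ih =>
    have h1 : p ^ (n + 1) ≤ 1 / 2 := by
      rw [pow_succ]
      have := pow_le_one₀ (n := n) hp (by linarith)
      nlinarith
    have h2 : q ^ (n + 1 + 1) - p ^ (n + 1 + 1) =
        q * (q ^ (n + 1) - p ^ (n + 1)) + p ^ (n + 1) * (q - p) := by ring
    rw [h2]
    nlinarith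

/-- Giving each factor of the product one power of `x` shows that `term d x j / x` is a constant
times a product of nondecreasing functions. -/
lemma mul_term_le_mul_term {d : ℕ} {p q : ℝ} (hp : 0 ≤ p) (hpq : p ≤ q) (hq : q ≤ 1 / 2)
    (j : ℕ) : q * term d p j ≤ p * term d q j := by
  have hfac : ∀ x : ℝ, term d x j =
      d ^ (j + 1) * x * ∏ i ∈ Finset.Icc 1 j, (x * (1 - x ^ i)) := fun x => by
    rw [term, Finset.prod_mul_distrib, Finset.prod_const, Nat.card_Icc, Nat.add_sub_cancel]
    ring
  have hle : ∏ i ∈ Finset.Icc 1 j, (p * (1 - p ^ i)) ≤ ∏ i ∈ Finset.Icc 1 j, (q * (1 - q ^ i)) := by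
    refine Finset.prod_le_prod (fun i _ => ?_) fun i _ => ?_
    · exact mul_nonneg hp (sub_nonneg.2 (pow_le_one₀ hp (by linarith)))
    · have := pow_sub_pow_le_sub hp hpq hq i
      rw [pow_succ, pow_succ] at this
      nlinarith
  rw [hfac, hfac]
  have := mul_le_mul_of_nonneg_left hle (show 0 ≤ (d : ℝ) ^ (j + 1) * (p * q) by
    have : 0 ≤ q := hp.trans hpq
    positivity)
  nlinarith

/-- The series has positive terms and begins with `d * q`. For `d ≥ 2` this places every root below
`1/2`, where the monotonicity holds. -/
lemma mul_lt_one_of_hasSum {d : ℕ} (hd : 0 < d) {q : ℝ} (hq0 : 0 < q) (hq1 : q < 1)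
    (h : HasSum (term d q) 1) : d * q < 1 := by
  have h2 := sum_le_hasSum (Finset.range 2) (fun i _ => (term_pos hd hq0 hq1 i).le) h
  have h1 := term_pos hd hq0 hq1 1
  rw [Finset.sum_range_succ, Finset.sum_range_one] at h2
  have h0 : term d q 0 = d * q := by simp [term]
  linarith

/-! ### Existence of a root and criteria for locating it. -/

lemma prod_nonneg_le_one {q : ℝ} (hq0 : 0 ≤ q) (hq1 : q ≤ 1) (j : ℕ) :
    0 ≤ ∏ i ∈ Finset.Icc 1 j, (1 - q ^ i) ∧ ∏ i ∈ Finset.Icc 1 j, (1 - q ^ i) ≤ 1 := by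
  have h0 : ∀ i ∈ Finset.Icc 1 j, 0 ≤ 1 - q ^ i := fun i _ =>
    sub_nonneg.2 (pow_le_one₀ hq0 hq1)
  refine ⟨Finset.prod_nonneg h0, Finset.prod_le_one h0 fun i _ => ?_⟩
  have := pow_nonneg hq0 i
  linarith

lemma summable_mul_prod {y q : ℝ} (hy0 : 0 ≤ y) (hy1 : y < 1) (hq0 : 0 ≤ q) (hq1 : q ≤ 1) :
    Summable fun j : ℕ => y ^ (j + 1) * ∏ i ∈ Finset.Icc 1 j, (1 - q ^ i) := by
  refine Summable.of_nonneg_of_le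
    (fun j => mul_nonneg (by positivity) (prod_nonneg_le_one hq0 hq1 j).1)
    (fun j => mul_le_of_le_one_right (by positivity) (prod_nonneg_le_one hq0 hq1 j).2)
    ((summable_nat_add_iff 1).2 (summable_geometric_of_lt_one hy0 hy1))

lemma summable_term {d : ℕ} {q : ℝ} (hq0 : 0 ≤ q) (hq1 : q ≤ 1) (h : d * q < 1) :
    Summable (term d q) :=
  summable_mul_prod (by positivity) h hq0 hq1

lemma continuousOn_tsum_term {d : ℕ} {b : ℝ} (hb0 : 0 ≤ b) (hb1 : b ≤ 1) (hb : d * b < 1) :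
    ContinuousOn (fun q => ∑' j, term d q j) (Set.Icc 0 b) := by
  refine continuousOn_tsum (u := fun j => ((d : ℝ) * b) ^ (j + 1)) (fun j => ?_)
    ((summable_nat_add_iff 1).2 (summable_geometric_of_lt_one (by positivity) hb))
    fun j x hx => ?_
  · unfold term; fun_prop
  · have h := prod_nonneg_le_one hx.1 (hx.2.trans hb1) j
    have hx0 := hx.1
    rw [term, Real.norm_of_nonneg (mul_nonneg (by positivity) h.1)]
    refine (mul_le_of_le_one_right (by positivity) h.2).trans ?_
    have := hx.2
    gcongr

lemma exists_hasSum_term {d : ℕ} {a b : ℝ} (ha0 : 0 ≤ a) (hab : a ≤ b) (hb1 : b ≤ 1)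
    (hb : d * b < 1) (ha : ∑' j, term d a j ≤ 1) (hb' : 1 ≤ ∑' j, term d b j) :
    ∃ q ∈ Set.Icc a b, HasSum (term d q) 1 := by
  obtain ⟨q, hq, hq'⟩ := intermediate_value_Icc hab
    ((continuousOn_tsum_term (ha0.trans hab) hb1 hb).mono (Set.Icc_subset_Icc_left ha0))
    (show (1 : ℝ) ∈ Set.Icc _ _ from ⟨ha, hb'⟩)
  refine ⟨q, hq, ?_⟩
  have hdq : d * q < 1 := (mul_le_mul_of_nonneg_left hq.2 (by positivity)).trans_lt hb
  have := (summable_term (ha0.trans hq.1) (hq.2.trans hb1) hdq).hasSum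
  simp only at hq'
  rwa [hq'] at this

/-- Expanding the last factor `1 - q ^ (j + 1)` gives a functional equation relating the series at
`y = d * q` to the same series at `y * q`. The latter converges faster, so crude bounds on it are
sharp enough. -/
lemma one_sub_mul_tsum_term {d : ℕ} {q : ℝ} (hq0 : 0 ≤ q) (hq1 : q ≤ 1) (h : d * q < 1) :
    (1 - d * q) * ∑' j, term d q j =
      d * q - d * q * ∑' j : ℕ, (d * q * q) ^ (j + 1) * ∏ i ∈ Finset.Icc 1 j, (1 - q ^ i) := by
  have hs := summable_term hq0 hq1 h
  have hy0 : 0 ≤ d * q := by positivity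
  have hs' := summable_mul_prod (y := d * q * q) (by positivity) (by nlinarith) hq0 hq1
  have h0 : term d q 0 = d * q := by simp [term]
  have h1 : ∀ j, term d q (j + 1) = d * q * term d q j -
      d * q * ((d * q * q) ^ (j + 1) * ∏ i ∈ Finset.Icc 1 j, (1 - q ^ i)) := fun j => by
    rw [term, term, Finset.prod_Icc_succ_top (by omega), mul_pow (d * q : ℝ) q (j + 1)]
    ring
  have h2 := hs.tsum_eq_zero_add
  simp_rw [h0, h1] at h2
  rw [(hs.mul_left _).tsum_sub (hs'.mul_left _), tsum_mul_left, tsum_mul_left] at h2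
  linarith

/-- The transformed series is bounded below by its first two terms. -/
lemma tsum_term_le_one {d : ℕ} {q : ℝ} (hq0 : 0 ≤ q) (hq1 : q ≤ 1) (h : d * q < 1)
    (hle : 2 * (d * q) - d * q * (d * q * q + (d * q * q) ^ 2 * (1 - q)) ≤ 1) :
    ∑' j, term d q j ≤ 1 := by
  have hy0 : 0 ≤ d * q := by positivity
  have hs' := summable_mul_prod (y := d * q * q) (by positivity) (by nlinarith) hq0 hq1
  have h1 := hs'.sum_le_tsum (Finset.range 2) fun j _ =>
    mul_nonneg (by positivity) (prod_nonneg_le_one hq0 hq1 j).1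
  have h2 := one_sub_mul_tsum_term hq0 hq1 h
  simp [Finset.sum_range_succ] at h1
  have h3 := mul_le_mul_of_nonneg_left h1 hy0
  by_contra hc
  push Not at hc
  nlinarith

/-- The transformed series is bounded above by a geometric series. -/
lemma one_le_tsum_term {d : ℕ} {q : ℝ} (hq0 : 0 ≤ q) (hq1 : q ≤ 1) (h : d * q < 1)
    (hle : 1 ≤ 2 * (d * q) - d * q * (d * q * q / (1 - d * q * q))) :
    1 ≤ ∑' j, term d q j := by
  have hy0 : 0 ≤ d * q := by positivity
  have hz1 : d * q * q < 1 := by nlinarith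
  have hz0 : 0 ≤ d * q * q := by positivity
  have hs' := summable_mul_prod hz0 hz1 hq0 hq1
  have hg := (hasSum_geometric_of_lt_one hz0 hz1).mul_left (d * q * q)
  have h1 := hs'.tsum_le_tsum (fun j => show _ ≤ d * q * q * (d * q * q) ^ j by
    rw [← pow_succ']
    exact mul_le_of_le_one_right (by positivity) (prod_nonneg_le_one hq0 hq1 j).2) hg.summable
  rw [hg.tsum_eq, ← div_eq_mul_inv] at h1
  have h2 := one_sub_mul_tsum_term hq0 hq1 h
  have h3 := mul_le_mul_of_nonneg_left h1 hy0
  by_contra hc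
  push Not at hc
  nlinarith

/-! ### Identification of the critical parameter. -/

lemma pow_succ_mul_reachWeight (d : ℕ) (q : ℝ) (j : ℕ) :
    (d : ℝ) ^ (j + 1) * reachWeight q (j + 1) = term d q j := by
  rw [reachWeight, term, mul_pow, Nat.add_sub_cancel]; ring

lemma pow_mul_coverProb_recursion (d : ℕ) (p : unitInterval) (hp : (p : ℝ) < 1) (n : ℕ) :
    (d : ℝ) ^ (n + 1) * coverProb p (n + 1) =
      ∑ m ∈ Finset.range (n + 1), (d : ℝ) ^ m * coverProb p m * term d p (n - m) := by
  rw [coverProb_recursion p hp n.succ_pos, Finset.mul_sum]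
  refine Finset.sum_congr rfl fun m hm => ?_
  have hm' : m ≤ n := by simp at hm; omega
  rw [← pow_succ_mul_reachWeight, show n - m + 1 = n + 1 - m by omega]
  have : (d : ℝ) ^ (n + 1) = d ^ m * d ^ (n + 1 - m) := by rw [← pow_add]; congr 1; omega
  rw [this]; ring

lemma coverProb_pos (p : unitInterval) (hp0 : 0 < (p : ℝ)) (hp1 : (p : ℝ) < 1) (n : ℕ) :
    0 < coverProb p n := by
  have hw : ∀ k, 0 < reachWeight p (k + 1) := fun k => by
    have := term_pos (d := 1) one_pos hp0 hp1 k
    rw [← pow_succ_mul_reachWeight] at this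
    simpa using this
  rcases n with _ | n
  · rw [coverProb_zero]; exact one_pos
  · rw [coverProb_recursion p hp1 n.succ_pos, Finset.sum_range_succ', coverProb_zero]
    refine add_pos_of_nonneg_of_pos (Finset.sum_nonneg fun m hm => ?_) (by simpa using hw n)
    rw [show n + 1 - (m + 1) = n - (m + 1) + 1 by simp at hm; omega]
    exact mul_nonneg (coverProb_nonneg p _) (hw _).le

lemma criticalParameter_eq {d : ℕ} (hd : 2 ≤ d) {q : ℝ} (hq0 : 0 < q) (hq1 : q < 1)
    (h : HasSum (term d q) 1) : criticalParameter d = q := by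
  have hd0 : 0 < d := by omega
  have hd2 : (2 : ℝ) ≤ d := by exact_mod_cast hd
  have hq2 : q < 1 / 2 := by
    have := mul_lt_one_of_hasSum hd0 hq0 hq1 h
    nlinarith
  have hpos : ∀ p : unitInterval, q < (p : ℝ) → (p : ℝ) ≤ 1 / 2 → 0 < percolationProb d p := by
    intro p hqp hp
    have hp0 := hq0.trans hqp
    have hp1 : (p : ℝ) < 1 := by linarith
    -- A partial sum at `q` exceeds `q / p < 1`; passing from `q` to `p` gains at least the factor
    -- `p / q`, which brings it above 1.
    have hlim := h.tendsto_sum_nat.eventually (lt_mem_nhds ((div_lt_one hp0).2 hqp))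
    obtain ⟨K, hK⟩ := hlim.exists
    rw [div_lt_iff₀ hp0] at hK
    have hK' : 1 < ∑ j ∈ Finset.range K, term d p j := by
      have := Finset.sum_le_sum fun j (_ : j ∈ Finset.range K) =>
        mul_term_le_mul_term (d := d) hq0.le hqp.le hp j
      rw [← Finset.mul_sum, ← Finset.mul_sum] at this
      nlinarith
    obtain ⟨N, hN⟩ := exists_one_lt_renewal
      (fun n => mul_pos (by positivity) (coverProb_pos p hp0 hp1 n))
      (fun j => (term_pos hd0 hp0 hp1 j).le) (pow_mul_coverProb_recursion d p hp1) hK'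
    exact percolationProb_pos hd0 p hN
  have hzero : ∀ p : unitInterval, 0 < (p : ℝ) → (p : ℝ) < q → percolationProb d p = 0 := by
    intro p hp0 hpq
    have hp1 := hpq.trans hq1
    refine percolationProb_eq_zero hd0 p (summable_renewal
      (fun n => mul_nonneg (by positivity) (coverProb_nonneg p n))
      (fun j => (term_pos hd0 hp0 hp1 j).le) (by simp [coverProb_zero])
      (pow_mul_coverProb_recursion d p hp1) ((div_lt_one hq0).2 hpq) fun K => ?_)
    rw [le_div_iff₀ hq0]
    have h1 := Finset.sum_le_sum fun j (_ : j ∈ Finset.range K) =>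
      mul_term_le_mul_term (d := d) hp0.le hpq.le hq2.le j
    rw [← Finset.mul_sum, ← Finset.mul_sum] at h1
    have h2 := sum_le_hasSum (Finset.range K) (fun i _ => (term_pos hd0 hq0 hq1 i).le) h
    nlinarith
  refine csInf_eq_of_forall_ge_of_forall_gt_exists_lt ?_ ?_ ?_
  · exact ⟨1 / 2, by norm_num, hpos _ hq2 le_rfl⟩
  · rintro p ⟨hp, hperc⟩
    by_contra hlt
    exact hperc.ne' (hzero _ hp.1 (not_le.1 hlt))
  -- Percolation for `p` in `(q, 1/2]` suffices for the infimum, so monotonicity of percolation in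
  -- `p` is not needed.
  · intro w hw
    obtain ⟨p, hqp, hp⟩ := exists_between (lt_min hw hq2)
    have hp2 := hp.trans_le (min_le_right _ _)
    exact ⟨p, ⟨⟨hq0.trans hqp, by linarith⟩, hpos _ hqp hp2.le⟩, hp.trans_le (min_le_left _ _)⟩

/-! ### Explicit bounds. -/

lemma criticalParameter_mem {d : ℕ} (hd : 2 ≤ d) {a b : ℝ} (ha0 : 0 < a) (hab : a ≤ b)
    (hb1 : b < 1) (hb : d * b < 1)
    (ha : 2 * (d * a) - d * a * (d * a * a + (d * a * a) ^ 2 * (1 - a)) ≤ 1)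
    (hb' : 1 ≤ 2 * (d * b) - d * b * (d * b * b / (1 - d * b * b))) :
    criticalParameter d ∈ Set.Icc a b ∧ criticalParameter d ∈ Set.Ioo (0 : ℝ) 1 ∧
      HasSum (term d (criticalParameter d)) 1 := by
  have hda : d * a < 1 := (mul_le_mul_of_nonneg_left hab (by positivity)).trans_lt hb
  obtain ⟨q, hq, hsum⟩ := exists_hasSum_term ha0.le hab hb1.le hb
    (tsum_term_le_one ha0.le (hab.trans hb1.le) hda ha)
    (one_le_tsum_term (ha0.le.trans hab) hb1.le hb hb')
  have hq0 := ha0.trans_le hq.1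
  have hq1 := hq.2.trans_lt hb1
  rw [criticalParameter_eq hd hq0 hq1 hsum]
  exact ⟨hq, ⟨hq0, hq1⟩, hsum⟩

lemma criticalParameter_two_mem :
    criticalParameter 2 ∈ Set.Icc (0.266667 : ℝ) 0.277206 ∧
      criticalParameter 2 ∈ Set.Ioo (0 : ℝ) 1 ∧ HasSum (term 2 (criticalParameter 2)) 1 :=
  criticalParameter_mem le_rfl (by norm_num) (by norm_num) (by norm_num) (by norm_num)
    (by norm_num) (by norm_num)

lemma criticalParameter_mem_of_three_le {d : ℕ} (hd : 3 ≤ d) :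
    criticalParameter d ∈ Set.Icc (1 / (2 * (d : ℝ) - 1 / 4))
        ((7 * (d : ℝ) - 1) * (1 - Real.sqrt (1 - 14 / (7 * (d : ℝ) - 1) ^ 2)) / 2) ∧
      criticalParameter d ∈ Set.Ioo (0 : ℝ) 1 ∧ HasSum (term d (criticalParameter d)) 1 := by
  have hd3 : (3 : ℝ) ≤ d := by exact_mod_cast hd
  set D : ℝ := (d : ℝ)
  set s := Real.sqrt (1 - 14 / (7 * D - 1) ^ 2) with hs
  set b := (7 * D - 1) * (1 - s) / 2 with hb
  set a := 1 / (2 * D - 1 / 4) with ha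
  have hB : (20 : ℝ) ≤ 7 * D - 1 := by linarith
  have hx : 14 / (7 * D - 1) ^ 2 ≤ 14 / 400 := by
    apply div_le_div_of_nonneg_left <;> nlinarith
  have hx0 : 0 < 14 / (7 * D - 1) ^ 2 := by positivity
  have hssq : s ^ 2 = 1 - 14 / (7 * D - 1) ^ 2 := Real.sq_sqrt (by linarith)
  have hs1 : s < 1 := by
    rw [hs, Real.sqrt_lt' one_pos]; linarith
  have hs0 : 98 / 100 ≤ s := Real.le_sqrt_of_sq_le (by linarith)
  have hmul : (7 * D - 1) ^ 2 * s ^ 2 = (7 * D - 1) ^ 2 - 14 := by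
    rw [hssq]; field_simp
  have hb0 : 0 < b := by
    have : 0 < 1 - s := by linarith
    positivity
  -- The bound `b` is the smaller root of `b ^ 2 - (7 * D - 1) * b + 7 / 2 = 0`.
  have hquad : D * b = 1 / 2 + b / 7 + b ^ 2 / 7 := by
    rw [hb]; linear_combination (-1 / 28) * hmul
  have hb5 : b ≤ 1 / 5 := by
    have h1 : b * ((7 * D - 1) * (1 + s)) = 7 := by rw [hb]; linear_combination (-1 / 2) * hmul
    have h2 : (39 : ℝ) ≤ (7 * D - 1) * (1 + s) := by nlinarith
    nlinarith
  have ha1 : a * (2 * D - 1 / 4) = 1 := one_div_mul_cancel (by linarith)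
  have ha0 : 0 < a := by
    have : 0 < 2 * D - 1 / 4 := by linarith
    positivity
  -- From here on only the algebraic relations for `a` and `b` matter, not their closed forms.
  clear_value a b
  have hDa : D * a = 1 / 2 + a / 8 := by linarith
  have hab : a ≤ b := by
    by_contra hc
    push Not at hc
    nlinarith
  refine criticalParameter_mem (by omega) ha0 hab (by linarith) ?_ ?_ ?_
  · change D * b < 1
    nlinarith
  · change 2 * (D * a) - D * a * (D * a * a + (D * a * a) ^ 2 * (1 - a)) ≤ 1
    rw [hDa]
    -- The cubic correction is discarded: `2 * D * a - 1 = a / 4` is already at most `(D * a) ^ 2 *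
    -- a`, since `D * a ≥ 1/2`.
    have h1 : 0 ≤ (1 / 2 + a / 8) * (((1 / 2 + a / 8) * a) ^ 2 * (1 - a)) :=
      mul_nonneg (by positivity) (mul_nonneg (by positivity) (by linarith))
    nlinarith [mul_pos ha0 ha0, mul_pos (mul_pos ha0 ha0) ha0]
  · change 1 ≤ 2 * (D * b) - D * b * (D * b * b / (1 - D * b * b))
    have hy : D * b ≤ 1 / 2 + b * (6 / 35) := by nlinarith
    have hyb : D * b * b ≤ 3 / 28 := by nlinarith
    have hkey : D * b * (D * b * b) ≤ (2 * (D * b) - 1) * (1 - D * b * b) := by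
      rw [hquad]
      -- The difference of the two sides is `b` times a bracket, which is at least `1/28 - 1/50 > 0`
      -- because `b ≤ 1/5`.
      have hfac : (2 * (1 / 2 + b / 7 + b ^ 2 / 7) - 1) * (1 - (1 / 2 + b / 7 + b ^ 2 / 7) * b) -
          (1 / 2 + b / 7 + b ^ 2 / 7) * ((1 / 2 + b / 7 + b ^ 2 / 7) * b) =
          b * (1 / 28 - b ^ 2 * (2 / 7 + 3 * (1 + b) ^ 2 / 49)) := by ring
      have h1 : b ^ 2 ≤ 1 / 25 := by nlinarith
      have h2 : 2 / 7 + 3 * (1 + b) ^ 2 / 49 ≤ 1 / 2 := by nlinarith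
      have h3 : b ^ 2 * (2 / 7 + 3 * (1 + b) ^ 2 / 49) ≤ 1 / 25 * (1 / 2) :=
        mul_le_mul h1 h2 (by positivity) (by norm_num)
      have h4 : 0 ≤ b * (1 / 28 - b ^ 2 * (2 / 7 + 3 * (1 + b) ^ 2 / 49)) :=
        mul_nonneg hb0.le (by linarith)
      linarith
    rw [← mul_div_assoc, le_sub_comm, div_le_iff₀ (by linarith)]
    exact hkey

end ConePercolation

theorem proposition1 :
    (∀ d : ℕ, 2 ≤ d →
      ConePercolation.criticalParameter d ∈ Set.Ioo (0 : ℝ) 1 ∧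
      ConePercolation.SolvesLocalization 1 d (ConePercolation.criticalParameter d) ∧
      ∀ q ∈ Set.Ioo (0 : ℝ) 1, ConePercolation.SolvesLocalization 1 d q →
        q = ConePercolation.criticalParameter d) ∧
    ((0.266667 : ℝ) ≤ ConePercolation.criticalParameter 2 ∧
      ConePercolation.criticalParameter 2 ≤ (0.277206 : ℝ)) ∧
    (∀ d : ℕ, 3 ≤ d →
      1 / (2 * (d : ℝ) - 1 / 4) ≤ ConePercolation.criticalParameter d ∧
      ConePercolation.criticalParameter d ≤
        (7 * (d : ℝ) - 1) * (1 - Real.sqrt (1 - 14 / (7 * (d : ℝ) - 1) ^ 2)) / 2) := by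
  refine ⟨fun d hd => ?_, ConePercolation.criticalParameter_two_mem.1,
    fun d hd => (ConePercolation.criticalParameter_mem_of_three_le hd).1⟩
  have h : ConePercolation.criticalParameter d ∈ Set.Ioo (0 : ℝ) 1 ∧
      HasSum (ConePercolation.term d (ConePercolation.criticalParameter d)) 1 := by
    rcases hd.eq_or_lt with rfl | hd
    · exact ConePercolation.criticalParameter_two_mem.2
    · exact (ConePercolation.criticalParameter_mem_of_three_le hd).2
  exact ⟨h.1, ConePercolation.solvesLocalization_one_iff.2 h.2, fun q hq hsol =>
    (ConePercolation.criticalParameter_eq hd hq.1 hq.2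
      (ConePercolation.solvesLocalization_one_iff.1 hsol)).symm⟩
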